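/- Let $n\ge 2$. For a measurable function $u$ on $\mathbb{R}^n$ let $$\mathcal{S}u(x)=\sup_{t>0}\frac{1}{\mathcal{H}^{n-1}(S^{n-1}(x,t))}\int_{S^{n-1}(x,t)}|u|\,d\mathcal{H}^{n-1}\in[0,\infty]$$ be its spherical maximal function, where $S^{n-1}(x,t)=\{z\in\mathbb{R}^n:|z-x|=t\}$ and $\mathcal{H}^{n-1}$ is the $(n-1)$-dimensional Hausdorff measure. Then there is a compactly supported $u\in W^{1,1}(\mathbb{R}^n)$, which can be taken nonnegative, such that $\mathcal{S}u\notin W^{1,1}_{\rm loc}(\mathbb{R}^n)$. More precisely, call $u:\mathbb{R}^n\to\mathbb{R}$ admissible if it has compact support, is $C^\infty$ on $\mathbb{R}^n\setminus\{0\}$, and $$u(x)=|x|^{1-n}\Big(\log\frac{e}{|x|}\Big)^{-1-\frac{n-1}{n}}\qquad\text{for }0<|x|<1 .$$ (The value $u(0)$ is arbitrary.) Nonnegative admissible functions exist, and every admissible $u$ satisfies $u\in W^{1,1}(\mathbb{R}^n)$ and $\mathcal{S}u\notin W^{1,1}_{\rm loc}(\mathbb{R}^n)$. Moreover, there is a constant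 $C=C(n)>0$ such that for every admissible $u$ and all $x$ with $0<|x|\le 1$, $$\mathcal{S}u(x)\;\ge\;\frac{1}{\mathcal{H}^{n-1}(S^{n-1}(x,|x|))}\int_{S^{n-1}(x,|x|)}|u|\,d\mathcal{H}^{n-1}\;\ge\; C\,|x|^{1-n}\Big(\log\frac{e}{|x|}\Big)^{-\frac{n-1}{n}},$$ and the function $x\mapsto |x|^{1-n}\big(\log\frac{e}{|x|}\big)^{-\frac{n-1}{n}}$ does not belong to $L^{n/(n-1)}(U)$ for any neighbourhood $U$ of the origin. -/

import Mathlib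

open MeasureTheory Topology
open scoped ENNReal ContDiff

/-- `G` is the weak gradient of `u` on `ℝⁿ`: for every smooth compactly supported test function `φ`
and every coordinate `i`, `∫ u ∂ᵢφ = - ∫ Gᵢ φ`. Only used for locally integrable `u` and `G`. -/
def IsWeakGradient {n : ℕ} (u : EuclideanSpace ℝ (Fin n) → ℝ)
    (G : EuclideanSpace ℝ (Fin n) → EuclideanSpace ℝ (Fin n)) : Prop :=
  ∀ φ : EuclideanSpace ℝ (Fin n) → ℝ, ContDiff ℝ ∞ φ → HasCompactSupport φ →
    ∀ i : Fin n,
      ∫ x, u x * fderiv ℝ φ x (EuclideanSpace.single i 1) = - ∫ x, G x i * φ x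

/-- `u ∈ W^{1,1}(ℝⁿ)`: `u` is integrable and has an integrable weak gradient. -/
def MemW11 {n : ℕ} (u : EuclideanSpace ℝ (Fin n) → ℝ) : Prop :=
  Integrable u ∧
    ∃ G : EuclideanSpace ℝ (Fin n) → EuclideanSpace ℝ (Fin n),
      Integrable G ∧ IsWeakGradient u G

/-- `f ∈ W^{1,1}_loc(ℝⁿ)` for a function with values in `[0, ∞]`: `f` agrees almost everywhere with a
real-valued locally integrable function that has a locally integrable weak gradient. -/
def MemW11Loc {n : ℕ} (f : EuclideanSpace ℝ (Fin n) → ℝ≥0∞) : Prop :=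
  ∃ g : EuclideanSpace ℝ (Fin n) → ℝ,
    (∀ᵐ x, (f x : EReal) = (g x : EReal)) ∧ LocallyIntegrable g ∧
    ∃ G : EuclideanSpace ℝ (Fin n) → EuclideanSpace ℝ (Fin n),
      LocallyIntegrable G ∧ IsWeakGradient g G

/-- The average of `|u|` over the sphere `S^{n-1}(x, t)` with respect to the
`(n-1)`-dimensional Hausdorff measure. -/
noncomputable def sphericalAverage {n : ℕ} (u : EuclideanSpace ℝ (Fin n) → ℝ)
    (x : EuclideanSpace ℝ (Fin n)) (t : ℝ) : ℝ≥0∞ :=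
  ⨍⁻ z in Metric.sphere x t, ‖u z‖ₑ ∂μH[(n : ℝ) - 1]

/-- The spherical maximal function `S u`, with values in `[0, ∞]`. -/
noncomputable def sphericalMaximal {n : ℕ} (u : EuclideanSpace ℝ (Fin n) → ℝ)
    (x : EuclideanSpace ℝ (Fin n)) : ℝ≥0∞ :=
  ⨆ t : ℝ, ⨆ _ : 0 < t, sphericalAverage u x t

/-- The radial function `|x|^{1-n} (log (e/|x|))^{-α}`, used for `x ≠ 0`. -/
noncomputable def radialLog {n : ℕ} (α : ℝ) (x : EuclideanSpace ℝ (Fin n)) : ℝ :=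
  ‖x‖ ^ (1 - (n : ℝ)) * Real.log (Real.exp 1 / ‖x‖) ^ (-α)

/-- `u` is a compactly supported extension of `|x|^{1-n} (log (e/|x|))^{-1-(n-1)/n}` from the
punctured open unit ball to `ℝⁿ` that is smooth away from the origin. The value of `u` at the
origin, where the formula is singular, is arbitrary. -/
structure IsSmoothExtension {n : ℕ} (u : EuclideanSpace ℝ (Fin n) → ℝ) : Prop where
  eq_formula : ∀ x, 0 < ‖x‖ → ‖x‖ < 1 → u x = radialLog (1 + ((n : ℝ) - 1) / n) x
  smooth : ContDiffOn ℝ ∞ u {0}ᶜ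
  compact_support : HasCompactSupport u

open Set Filter Module Metric Real
open scoped Convolution NNReal RealInnerProductSpace

/-!
Write `β = (n - 1) / n`. Differentiating the profile `|x|^{1-n} (log (e/|x|))^{-(1+β)}` costs a
factor `|x|⁻¹`, and `|x|^{-n} (log (e/|x|))^{-(1+β)}` is integrable near the origin because
`1 + β > 1`; cutting off the singularity then shows that the classical gradient is the weak one.

The sphere `S(x, |x|)` passes through the origin, and its part close to the origin projects onto a
ball of the hyperplane `xᗮ` without increasing distances while changing `|z|` by a factor of at most
`2`. In dimension `n - 1` the factor `|y|^{1-n}` is critical, so integrating over this ball turns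
`log^{-(1+β)}` into `log^{-β}`: the spherical average gains a full power of the logarithm. The
resulting lower bound has `n/(n-1)`-th power `|x|^{-n} (log (e/|x|))^{-1}`, which just fails to be
integrable, whereas the Gagliardo–Nirenberg–Sobolev inequality embeds `W^{1,1}_loc` into
`L^{n/(n-1)}_loc`.
-/

lemma log_exp_one_div_nonneg {s : ℝ} (hs : 0 ≤ s) (hs1 : s ≤ exp 1) : 0 ≤ log (exp 1 / s) := by
  rcases hs.eq_or_lt with rfl | h
  · simp
  · exact log_nonneg ((one_le_div h).2 hs1)

lemma log_exp_one_div_pos {s : ℝ} (hs : 0 < s) (hs1 : s < exp 1) : 0 < log (exp 1 / s) :=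
  log_pos ((one_lt_div hs).2 hs1)

lemma log_exp_one_div {s : ℝ} (hs : s ≠ 0) : log (exp 1 / s) = 1 - log s := by
  rw [log_div (exp_ne_zero _) hs, log_exp]

lemma one_le_log_exp_one_div {s : ℝ} (hs : 0 < s) (hs1 : s ≤ 1) : 1 ≤ log (exp 1 / s) := by
  rw [log_exp_one_div hs.ne']
  linarith [log_nonpos hs.le hs1]

lemma hasDerivAt_log_exp_one_div {s : ℝ} (hs : s ≠ 0) :
    HasDerivAt (fun s ↦ log (exp 1 / s)) (-s⁻¹) s := by
  refine (((hasDerivAt_log hs).const_sub 1).congr_of_eventuallyEq ?_)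
  filter_upwards [isOpen_ne.mem_nhds hs] with t ht using log_exp_one_div ht

lemma hasDerivAt_log_exp_one_div_rpow (γ : ℝ) {s : ℝ} (hs : 0 < s) (hs1 : s < exp 1) :
    HasDerivAt (fun s ↦ log (exp 1 / s) ^ (-γ))
      (γ * (s⁻¹ * log (exp 1 / s) ^ (-(1 + γ)))) s := by
  convert! (hasDerivAt_log_exp_one_div hs.ne').rpow_const (p := -γ)
    (Or.inl (log_exp_one_div_pos hs hs1).ne') using 1
  rw [show -γ - 1 = -(1 + γ) by ring]
  ring

lemma tendsto_log_exp_one_div_nhdsGT_zero :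
    Tendsto (fun s ↦ log (exp 1 / s)) (𝓝[>] 0) atTop :=
  tendsto_log_atTop.comp ((tendsto_inv_nhdsGT_zero).const_mul_atTop (exp_pos 1))

lemma continuousOn_log_exp_one_div_rpow {β ρ : ℝ} (hβ : 0 < β) (hρ : ρ < exp 1) :
    ContinuousOn (fun s ↦ log (exp 1 / s) ^ (-β)) (Icc 0 ρ) := by
  intro s hs
  rcases hs.1.eq_or_lt with rfl | h
  · have hlim : Tendsto (fun s ↦ log (exp 1 / s) ^ (-β)) (𝓝[>] 0) (𝓝 0) :=
      (tendsto_rpow_neg_atTop hβ).comp tendsto_log_exp_one_div_nhdsGT_zero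
    have h0 : ContinuousWithinAt (fun s ↦ log (exp 1 / s) ^ (-β)) (Ioi 0) 0 := by
      simpa [ContinuousWithinAt, zero_rpow (neg_ne_zero.2 hβ.ne')] using hlim
    exact (continuousWithinAt_Ioi_iff_Ici.1 h0).mono Icc_subset_Ici_self
  · exact (hasDerivAt_log_exp_one_div_rpow β h
      (hs.2.trans_lt hρ)).continuousAt.continuousWithinAt

lemma intervalIntegrable_inv_mul_log_rpow {β ρ : ℝ} (hβ : 0 < β) (h0 : 0 ≤ ρ) (hρ : ρ < exp 1) :
    IntervalIntegrable (fun s ↦ s⁻¹ * log (exp 1 / s) ^ (-(1 + β))) volume 0 ρ := by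
  have h := intervalIntegral.intervalIntegrable_deriv_of_nonneg (a := 0) (b := ρ)
    (g := fun s ↦ log (exp 1 / s) ^ (-β))
    (g' := fun s ↦ β * (s⁻¹ * log (exp 1 / s) ^ (-(1 + β)))) ?_ ?_ ?_
  · simpa [← mul_assoc, hβ.ne'] using h.const_mul β⁻¹
  · rw [uIcc_of_le h0]
    exact continuousOn_log_exp_one_div_rpow hβ hρ
  · rw [min_eq_left h0, max_eq_right h0]
    exact fun s hs ↦ hasDerivAt_log_exp_one_div_rpow β hs.1 (hs.2.trans hρ)
  · rw [min_eq_left h0, max_eq_right h0]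
    intro s hs
    have hlog := log_exp_one_div_pos hs.1 (hs.2.trans hρ)
    have hs0 := hs.1
    positivity

lemma integral_inv_mul_log_rpow {β ρ : ℝ} (hβ : 0 < β) (h0 : 0 ≤ ρ) (hρ : ρ < exp 1) :
    ∫ s in (0 : ℝ)..ρ, s⁻¹ * log (exp 1 / s) ^ (-(1 + β)) = β⁻¹ * log (exp 1 / ρ) ^ (-β) := by
  have h := intervalIntegral.integral_eq_sub_of_hasDerivAt_of_le h0
    (continuousOn_log_exp_one_div_rpow hβ hρ)
    (fun s hs ↦ hasDerivAt_log_exp_one_div_rpow β hs.1 (hs.2.trans hρ))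
    ((intervalIntegrable_inv_mul_log_rpow hβ h0 hρ).const_mul β)
  rw [intervalIntegral.integral_const_mul] at h
  rw [eq_inv_mul_iff_mul_eq₀ hβ.ne', h]
  simp [zero_rpow (neg_ne_zero.2 hβ.ne')]

lemma not_integrableOn_inv_mul_log_inv {ρ : ℝ} (hρ : 0 < ρ) :
    ¬ IntegrableOn (fun s ↦ s⁻¹ * log (exp 1 / s) ^ (-1 : ℝ)) (Ioo 0 ρ) := by
  have hderiv : ∀ᶠ s in 𝓝[>] (0 : ℝ), HasDerivAt (fun s ↦ log (log (exp 1 / s)))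
      (-(s⁻¹ * log (exp 1 / s) ^ (-1 : ℝ))) s := by
    filter_upwards [Ioo_mem_nhdsGT (exp_pos 1)] with s hs
    convert! (hasDerivAt_log_exp_one_div hs.1.ne').log (log_exp_one_div_pos hs.1 hs.2).ne' using 1
    rw [rpow_neg_one]
    ring
  have hlim : Tendsto (fun s ↦ ‖log (log (exp 1 / s))‖) (𝓝[>] 0) atTop :=
    tendsto_norm_atTop_atTop.comp (tendsto_log_atTop.comp tendsto_log_exp_one_div_nhdsGT_zero)
  refine not_integrableOn_of_tendsto_norm_atTop_of_deriv_isBigO_filter _ (Ioo_mem_nhdsGT hρ)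
    (hderiv.mono fun s h ↦ h.differentiableAt) hlim
    (Asymptotics.IsBigO.of_bound 1 (hderiv.mono fun s h ↦ ?_))
  rw [h.deriv, norm_neg, one_mul]

section RadialIntegrals

variable {E : Type*} [NormedAddCommGroup E] [NormedSpace ℝ E] [FiniteDimensional ℝ E]
  [Nontrivial E] [MeasurableSpace E] [BorelSpace E] (μ : Measure E) [μ.IsAddHaarMeasure]

lemma pow_pred_mul_rpow_neg_mul {d : ℕ} (hd : 0 < d) {s : ℝ} (hs : 0 < s) (a : ℝ) :
    s ^ (d - 1) * (s ^ (-(d : ℝ)) * a) = s⁻¹ * a := by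
  rw [← mul_assoc, rpow_neg hs.le, rpow_natCast, pow_sub₀ _ hs.ne' hd, pow_one]
  field_simp

lemma integrableOn_ball_norm_rpow_mul_log_iff {γ ρ : ℝ} :
    IntegrableOn (fun x : E ↦ ‖x‖ ^ (-(finrank ℝ E : ℝ)) * log (exp 1 / ‖x‖) ^ (-γ))
      (ball 0 ρ) μ ↔
    IntegrableOn (fun s ↦ s⁻¹ * log (exp 1 / s) ^ (-γ)) (Ioo 0 ρ) := by
  rw [integrableOn_fun_norm_addHaar μ
    (f := fun s ↦ s ^ (-(finrank ℝ E : ℝ)) * log (exp 1 / s) ^ (-γ))]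
  exact integrableOn_congr_fun
    (fun s hs ↦ pow_pred_mul_rpow_neg_mul finrank_pos hs.1 _) measurableSet_Ioo

lemma integrableOn_ball_norm_rpow_mul_log {β ρ : ℝ} (hβ : 0 < β) (hρ : ρ < exp 1) :
    IntegrableOn (fun x : E ↦ ‖x‖ ^ (-(finrank ℝ E : ℝ)) * log (exp 1 / ‖x‖) ^ (-(1 + β)))
      (ball 0 ρ) μ := by
  rcases le_or_gt 0 ρ with h0 | h0
  · rw [integrableOn_ball_norm_rpow_mul_log_iff, ← integrableOn_Ioc_iff_integrableOn_Ioo,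
      ← intervalIntegrable_iff_integrableOn_Ioc_of_le h0]
    exact intervalIntegrable_inv_mul_log_rpow hβ h0 hρ
  · simp [ball_eq_empty.2 h0.le]

lemma setIntegral_ball_norm_rpow_mul_log {β ρ : ℝ} (hβ : 0 < β) (h0 : 0 ≤ ρ) (hρ : ρ < exp 1) :
    ∫ x in ball (0 : E) ρ, ‖x‖ ^ (-(finrank ℝ E : ℝ)) * log (exp 1 / ‖x‖) ^ (-(1 + β)) ∂μ =
      finrank ℝ E * μ.real (ball 0 1) * (β⁻¹ * log (exp 1 / ρ) ^ (-β)) := by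
  set f : ℝ → ℝ := fun s ↦ s ^ (-(finrank ℝ E : ℝ)) * log (exp 1 / s) ^ (-(1 + β))
  have hball : (ball (0 : E) ρ).indicator (fun x ↦ f ‖x‖) = fun x ↦ (Iio ρ).indicator f ‖x‖ := by
    ext x
    simp [indicator]
  have hpolar : ∫ s in Ioi (0 : ℝ), s ^ (finrank ℝ E - 1) • (Iio ρ).indicator f s =
      ∫ s in Ioo 0 ρ, s⁻¹ * log (exp 1 / s) ^ (-(1 + β)) := by
    simp only [← indicator_smul_apply (Iio ρ) (fun s : ℝ ↦ s ^ (finrank ℝ E - 1)) f]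
    rw [setIntegral_indicator measurableSet_Iio, Ioi_inter_Iio]
    exact setIntegral_congr_fun measurableSet_Ioo
      fun s hs ↦ pow_pred_mul_rpow_neg_mul finrank_pos hs.1 _
  rw [← integral_indicator measurableSet_ball, hball, integral_fun_norm_addHaar μ, hpolar,
    ← integral_inv_mul_log_rpow hβ h0 hρ, intervalIntegral.integral_of_le h0,
    integral_Ioc_eq_integral_Ioo, nsmul_eq_mul, smul_eq_mul, mul_assoc]

lemma setLIntegral_ball_norm_rpow_mul_log {β ρ : ℝ} (hβ : 0 < β) (h0 : 0 ≤ ρ) (hρ : ρ < exp 1) :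
    ∫⁻ x in ball (0 : E) ρ, ENNReal.ofReal
        (‖x‖ ^ (-(finrank ℝ E : ℝ)) * log (exp 1 / ‖x‖) ^ (-(1 + β))) ∂μ =
      ENNReal.ofReal (finrank ℝ E * μ.real (ball 0 1) * (β⁻¹ * log (exp 1 / ρ) ^ (-β))) := by
  rw [← setIntegral_ball_norm_rpow_mul_log μ hβ h0 hρ, ofReal_integral_eq_lintegral_ofReal
    (integrableOn_ball_norm_rpow_mul_log μ hβ hρ)]
  refine ae_restrict_of_forall_mem measurableSet_ball fun x hx ↦ ?_
  have hlog := log_exp_one_div_nonneg (norm_nonneg x) ((mem_ball_zero_iff.1 hx).trans hρ).le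
  simp only [Pi.zero_apply]
  positivity

end RadialIntegrals

section RadialLog

variable {n : ℕ}

lemma radialLog_nonneg (α : ℝ) {x : EuclideanSpace ℝ (Fin n)} (hx : ‖x‖ ≤ exp 1) :
    0 ≤ radialLog α x :=
  mul_nonneg (rpow_nonneg (norm_nonneg x) _)
    (rpow_nonneg (log_exp_one_div_nonneg (norm_nonneg x) hx) _)

lemma radialLog_rpow (α p : ℝ) {x : EuclideanSpace ℝ (Fin n)} (hx : ‖x‖ ≤ exp 1) :
    radialLog α x ^ p = ‖x‖ ^ ((1 - (n : ℝ)) * p) * log (exp 1 / ‖x‖) ^ (-α * p) := by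
  have hlog := log_exp_one_div_nonneg (norm_nonneg x) hx
  rw [radialLog, mul_rpow (by positivity) (by positivity), ← rpow_mul (norm_nonneg x),
    ← rpow_mul hlog]

lemma nontrivial_euclideanSpace_fin (hn : 0 < n) : Nontrivial (EuclideanSpace ℝ (Fin n)) :=
  nontrivial_of_finrank_pos (R := ℝ) (by rwa [finrank_euclideanSpace_fin])

lemma not_memLp_radialLog (hn : 2 ≤ n) {U : Set (EuclideanSpace ℝ (Fin n))} (hU : U ∈ 𝓝 0) :
    ¬ MemLp (radialLog (((n : ℝ) - 1) / n) : EuclideanSpace ℝ (Fin n) → ℝ)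
      (ENNReal.ofReal ((n : ℝ) / ((n : ℝ) - 1))) (volume.restrict U) := by
  intro h
  have hn1 : (0 : ℝ) < (n : ℝ) - 1 := by
    have : (2 : ℝ) ≤ n := by exact_mod_cast hn
    linarith
  have := nontrivial_euclideanSpace_fin (by omega : 0 < n)
  obtain ⟨ρ, hρ, hρU⟩ := Metric.mem_nhds_iff.1 hU
  have hp : 0 < (n : ℝ) / (n - 1) := by positivity
  have hint := (h.mono_measure (Measure.restrict_mono
    ((ball_subset_ball (min_le_left ρ 1)).trans hρU) le_rfl)).integrable_norm_rpow
    (by simpa using hp) (by simp)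
  refine not_integrableOn_inv_mul_log_inv (lt_min hρ one_pos) ?_
  rw [← integrableOn_ball_norm_rpow_mul_log_iff (volume : Measure (EuclideanSpace ℝ (Fin n)))]
  refine IntegrableOn.congr_fun hint (fun x hx ↦ ?_) measurableSet_ball
  have hx1 : ‖x‖ ≤ exp 1 := (mem_ball_zero_iff.1 hx).le.trans
    ((min_le_right _ _).trans (one_le_exp zero_le_one))
  rw [ENNReal.toReal_ofReal hp.le, finrank_euclideanSpace_fin,
    norm_of_nonneg (radialLog_nonneg _ hx1), radialLog_rpow _ _ hx1]
  congr 2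
  · field_simp
    ring
  · field_simp

end RadialLog

section WeakLineDeriv

variable {E F : Type*} [NormedAddCommGroup E] [NormedSpace ℝ E]
  [NormedAddCommGroup F] [NormedSpace ℝ F] [MeasurableSpace E] {μ : Measure E}
  {u g : E → F} {v : E}

/-- `g` is the weak derivative of `u` in the direction `v` with respect to `μ`. Like
`IsWeakGradient`, this is only used for locally integrable `u` and `g`. -/
def IsWeakLineDeriv (μ : Measure E) (u : E → F) (v : E) (g : E → F) : Prop :=
  ∀ φ : E → ℝ, ContDiff ℝ ∞ φ → HasCompactSupport φ →
    ∫ x, fderiv ℝ φ x v • u x ∂μ = -∫ x, φ x • g x ∂μ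

lemma isWeakGradient_iff_isWeakLineDeriv {n : ℕ} {u : EuclideanSpace ℝ (Fin n) → ℝ}
    {G : EuclideanSpace ℝ (Fin n) → EuclideanSpace ℝ (Fin n)} :
    IsWeakGradient u G ↔
      ∀ i, IsWeakLineDeriv volume u (EuclideanSpace.single i 1) fun x ↦ G x i := by
  simp only [IsWeakGradient, IsWeakLineDeriv, smul_eq_mul, mul_comm]
  exact ⟨fun h i φ hφ hφc ↦ h φ hφ hφc i, fun h φ hφ hφc i ↦ h i φ hφ hφc⟩

lemma IsWeakLineDeriv.smul_contDiff [OpensMeasurableSpace E] (h : IsWeakLineDeriv μ u v g)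
    (hu : LocallyIntegrable u μ) (hg : LocallyIntegrable g μ) {χ : E → ℝ} (hχ : ContDiff ℝ ∞ χ) :
    IsWeakLineDeriv μ (fun x ↦ χ x • u x) v fun x ↦ χ x • g x + fderiv ℝ χ x v • u x := by
  intro φ hφ hφc
  have hχ' : Continuous fun x ↦ fderiv ℝ χ x v :=
    (hχ.continuous_fderiv (by simp)).clm_apply continuous_const
  have hφ' : Continuous fun x ↦ fderiv ℝ φ x v :=
    (hφ.continuous_fderiv (by simp)).clm_apply continuous_const
  have hleibniz (x : E) : fderiv ℝ (fun x ↦ φ x * χ x) x v =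
      fderiv ℝ φ x v * χ x + φ x * fderiv ℝ χ x v := by
    rw [fderiv_fun_mul (hφ.differentiable (by simp) x) (hχ.differentiable (by simp) x)]
    simp [mul_comm, add_comm]
  have h₁ : Integrable (fun x ↦ (fderiv ℝ φ x v * χ x) • u x) μ :=
    hu.integrable_smul_left_of_hasCompactSupport (hφ'.mul hχ.continuous)
      (hφc.fderiv_apply (𝕜 := ℝ) v).mul_right
  have h₂ : Integrable (fun x ↦ (φ x * fderiv ℝ χ x v) • u x) μ :=
    hu.integrable_smul_left_of_hasCompactSupport (hφ.continuous.mul hχ') hφc.mul_right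
  have h₃ : Integrable (fun x ↦ (φ x * χ x) • g x) μ :=
    hg.integrable_smul_left_of_hasCompactSupport (hφ.continuous.mul hχ.continuous) hφc.mul_right
  have key := h (fun x ↦ φ x * χ x) (hφ.mul hχ) hφc.mul_right
  simp only [hleibniz, add_smul] at key
  rw [integral_add h₁ h₂] at key
  simp only [smul_add, smul_smul]
  rw [integral_add h₃ h₂, eq_neg_iff_add_eq_zero, ← add_assoc, add_right_comm, key,
    neg_add_cancel]

end WeakLineDeriv

section Mollification

lemma exists_enorm_le_mul_sum_enorm_basis {E F ι : Type*} [NormedAddCommGroup E] [NormedSpace ℝ E]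
    [NormedAddCommGroup F] [NormedSpace ℝ F] [Fintype ι] (b : Basis ι ℝ E) :
    ∃ C : ℝ≥0, ∀ L : E →L[ℝ] F, ‖L‖ₑ ≤ C * ∑ i, ‖L (b i)‖ₑ := by
  obtain ⟨C, -, hC⟩ := b.exists_opNNNorm_le (F := F)
  refine ⟨C, fun L ↦ ?_⟩
  have h : ‖L‖₊ ≤ C * ∑ i, ‖L (b i)‖₊ :=
    hC _ fun i ↦ Finset.single_le_sum (f := fun i ↦ ‖L (b i)‖₊) (by simp) (Finset.mem_univ i)
  simpa [enorm_eq_nnnorm] using ENNReal.coe_le_coe.2 h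

lemma lintegral_lconvolution {G : Type*} [AddGroup G] [MeasurableSpace G] [MeasurableAdd₂ G]
    [MeasurableNeg G] {μ : Measure G} [SFinite μ] [μ.IsAddLeftInvariant] {f g : G → ℝ≥0∞}
    (hf : AEMeasurable f μ) (hg : AEMeasurable g μ) :
    ∫⁻ x, (f ⋆ₗ[μ] g) x ∂μ = (∫⁻ x, f x ∂μ) * ∫⁻ x, g x ∂μ := by
  simp only [lconvolution_def]
  rw [lintegral_lintegral_swap (by fun_prop), ← lintegral_mul_const'' _ hf]
  refine lintegral_congr fun y ↦ ?_
  have hy : AEMeasurable (fun x ↦ g (-y + x)) μ :=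
    hg.comp_quasiMeasurePreserving (measurePreserving_add_left μ (-y)).quasiMeasurePreserving
  rw [lintegral_const_mul'' _ hy, lintegral_add_left_eq_self g]

variable {E F : Type*} [NormedAddCommGroup E] [NormedSpace ℝ E] [FiniteDimensional ℝ E]
  [MeasurableSpace E] [BorelSpace E] [NormedAddCommGroup F] [NormedSpace ℝ F]
  {μ : Measure E} [μ.IsAddHaarMeasure] {u g : E → F} {v : E}

lemma eLpNorm_one_convolution_lsmul_le {f : E → ℝ} (hf : AEStronglyMeasurable f μ)
    (hg : AEStronglyMeasurable g μ) :
    eLpNorm (f ⋆[ContinuousLinearMap.lsmul ℝ ℝ, μ] g) 1 μ ≤ eLpNorm f 1 μ * eLpNorm g 1 μ := by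
  simp only [eLpNorm_one_eq_lintegral_enorm]
  rw [← lintegral_lconvolution hf.enorm hg.enorm]
  refine lintegral_mono fun x ↦ (enorm_integral_le_lintegral_enorm _).trans_eq ?_
  simp [lconvolution_def, enorm_smul, sub_eq_neg_add]

lemma IsWeakLineDeriv.fderiv_convolution_apply (h : IsWeakLineDeriv μ u v g)
    (hu : LocallyIntegrable u μ) {φ : E → ℝ} (hφ : ContDiff ℝ ∞ φ) (hφc : HasCompactSupport φ)
    (x : E) :
    fderiv ℝ (φ ⋆[ContinuousLinearMap.lsmul ℝ ℝ, μ] u) x v =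
      (φ ⋆[ContinuousLinearMap.lsmul ℝ ℝ, μ] g) x := by
  have hφ₁ : ContDiff ℝ 1 φ := hφ.of_le (by simp)
  have hint : Integrable (fun t ↦ (ContinuousLinearMap.lsmul ℝ ℝ).precompL E
      (fderiv ℝ φ (x - t)) (u t)) μ :=
    ((hφc.fderiv (𝕜 := ℝ)).convolutionExists_left
      ((ContinuousLinearMap.lsmul ℝ ℝ : ℝ →L[ℝ] F →L[ℝ] F).precompL E)
      (hφ₁.continuous_fderiv one_ne_zero) hu x).integrable_swap
  have hderiv (t : E) : fderiv ℝ (fun t ↦ φ (x - t)) t v = -fderiv ℝ φ (x - t) v := by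
    have hcomp : HasFDerivAt (fun t ↦ φ (x - t)) _ t :=
      (hφ₁.differentiable one_ne_zero (x - t)).hasFDerivAt.comp t ((hasFDerivAt_id t).const_sub x)
    simp [hcomp.fderiv]
  have key := h (fun t ↦ φ (x - t)) (hφ.comp (contDiff_const.sub contDiff_id))
    (hφc.comp_homeomorph (Homeomorph.subLeft x))
  simp only [hderiv, neg_smul, integral_neg, neg_inj] at key
  rw [(hφc.hasFDerivAt_convolution_left (ContinuousLinearMap.lsmul ℝ ℝ) hφ₁ hu x).fderiv,
    convolution_eq_swap, convolution_eq_swap, ContinuousLinearMap.integral_apply hint]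
  exact key

variable {ι : Type*} {b : Basis ι ℝ E} {G : ι → E → F}

lemma eLpNorm_one_fderiv_convolution_normed_le [Fintype ι] {C : ℝ≥0}
    (hC : ∀ L : E →L[ℝ] F, ‖L‖ₑ ≤ C * ∑ i, ‖L (b i)‖ₑ)
    (hu : LocallyIntegrable u μ) (hG : ∀ i, AEStronglyMeasurable (G i) μ)
    (h : ∀ i, IsWeakLineDeriv μ u (b i) (G i)) (φ : ContDiffBump (0 : E)) :
    eLpNorm (fderiv ℝ (φ.normed μ ⋆[ContinuousLinearMap.lsmul ℝ ℝ, μ] u)) 1 μ ≤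
      C * ∑ i, eLpNorm (G i) 1 μ := by
  have hφ : eLpNorm (φ.normed μ) 1 μ = 1 := by
    rw [eLpNorm_one_eq_lintegral_enorm, ← ofReal_integral_norm_eq_lintegral_enorm
      φ.integrable_normed]
    simp [norm_of_nonneg (φ.nonneg_normed _), φ.integral_normed]
  have hφu : ContDiff ℝ 1 (φ.normed μ ⋆[ContinuousLinearMap.lsmul ℝ ℝ, μ] u) := by
    exact_mod_cast φ.hasCompactSupport_normed.contDiff_convolution_left
      (ContinuousLinearMap.lsmul ℝ ℝ) (φ.contDiff_normed (n := 1)) hu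
  have hconv (i : ι) : eLpNorm
      (fun x ↦ fderiv ℝ (φ.normed μ ⋆[ContinuousLinearMap.lsmul ℝ ℝ, μ] u) x (b i)) 1 μ ≤
      eLpNorm (G i) 1 μ := by
    simp only [(h i).fderiv_convolution_apply hu φ.contDiff_normed φ.hasCompactSupport_normed]
    simpa [hφ] using eLpNorm_one_convolution_lsmul_le
      (φ.continuous_normed (μ := μ)).aestronglyMeasurable (hG i)
  simp only [eLpNorm_one_eq_lintegral_enorm] at hconv ⊢
  refine (lintegral_mono fun x ↦ hC _).trans ?_
  rw [lintegral_const_mul' _ _ ENNReal.coe_ne_top, lintegral_finsetSum]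
  · exact mul_le_mul_right (Finset.sum_le_sum fun i _ ↦ hconv i) _
  · exact fun i _ ↦
      ((hφu.continuous_fderiv one_ne_zero).clm_apply continuous_const).enorm.measurable

/-- Mollify, apply the smooth Gagliardo–Nirenberg–Sobolev inequality, and pass to the limit by
Fatou's lemma. -/
lemma exists_eLpNorm_le_mul_sum_eLpNorm_weakLineDeriv [Fintype ι] [CompleteSpace F]
    (μ : Measure E) [μ.IsAddHaarMeasure] (b : Basis ι ℝ E) {p : ℝ≥0}
    (hp : NNReal.HolderConjugate (finrank ℝ E) p) :
    ∃ C : ℝ≥0, ∀ (u : E → F) (G : ι → E → F), LocallyIntegrable u μ → HasCompactSupport u →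
      (∀ i, AEStronglyMeasurable (G i) μ) → (∀ i, IsWeakLineDeriv μ u (b i) (G i)) →
      eLpNorm u p μ ≤ C * ∑ i, eLpNorm (G i) 1 μ := by
  obtain ⟨C, hC⟩ := exists_enorm_le_mul_sum_enorm_basis (F := F) b
  refine ⟨eLpNormLESNormFDerivOneConst μ p * C, fun u G hu huc hG h ↦ ?_⟩
  let φ (k : ℕ) : ContDiffBump (0 : E) :=
    ⟨1 / ((k : ℝ) + 1), 2 * (1 / ((k : ℝ) + 1)), by positivity,
      lt_mul_of_one_lt_left (by positivity) one_lt_two⟩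
  let w (k : ℕ) : E → F := (φ k).normed μ ⋆[ContinuousLinearMap.lsmul ℝ ℝ, μ] u
  have hw (k : ℕ) : ContDiff ℝ 1 (w k) := by
    exact_mod_cast (φ k).hasCompactSupport_normed.contDiff_convolution_left
      (ContinuousLinearMap.lsmul ℝ ℝ) ((φ k).contDiff_normed (n := 1)) hu
  have hwc (k : ℕ) : HasCompactSupport (w k) :=
    (φ k).hasCompactSupport_normed.convolution (ContinuousLinearMap.lsmul ℝ ℝ) huc
  have hφ : Tendsto (fun k ↦ (φ k).rOut) atTop (𝓝 0) := by
    have := tendsto_one_div_add_atTop_nhds_zero_nat (𝕜 := ℝ).const_mul 2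
    rwa [mul_zero] at this
  have hlim : ∀ᵐ x ∂μ, Tendsto (fun k ↦ w k x) atTop (𝓝 (u x)) :=
    ContDiffBump.ae_convolution_tendsto_right_of_locallyIntegrable (K := 2) hφ
      (Eventually.of_forall fun k ↦ le_rfl) hu
  have hbound (k : ℕ) : eLpNorm (w k) p μ ≤
      ↑(eLpNormLESNormFDerivOneConst μ p * C) * ∑ i, eLpNorm (G i) 1 μ := by
    refine (eLpNorm_le_eLpNorm_fderiv_one μ (hw k) (hwc k) hp).trans ?_
    rw [ENNReal.coe_mul, mul_assoc]
    gcongr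
    exact eLpNorm_one_fderiv_convolution_normed_le hC hu hG h (φ k)
  calc eLpNorm u p μ ≤ atTop.liminf fun k ↦ eLpNorm (w k) p μ :=
        Lp.eLpNorm_lim_le_liminf_eLpNorm (fun k ↦ (hw k).continuous.aestronglyMeasurable) u hlim
    _ ≤ _ := liminf_le_of_frequently_le' (Frequently.of_forall hbound)

lemma memLp_restrict_of_isWeakLineDeriv [Finite ι] [CompleteSpace F] {p : ℝ≥0}
    (hp : NNReal.HolderConjugate (finrank ℝ E) p) (hu : LocallyIntegrable u μ)
    (hG : ∀ i, LocallyIntegrable (G i) μ) (h : ∀ i, IsWeakLineDeriv μ u (b i) (G i))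
    {K : Set E} (hK : IsCompact K) : MemLp u p (μ.restrict K) := by
  have := Fintype.ofFinite ι
  obtain ⟨R, hR, hKR⟩ := hK.isBounded.subset_closedBall_lt 0 0
  let χ : ContDiffBump (0 : E) := ⟨R, R + 1, hR, by linarith⟩
  have hχ : ContDiff ℝ ∞ χ := χ.contDiff
  have hχc : HasCompactSupport χ := χ.hasCompactSupport
  have hχu : LocallyIntegrable (fun x ↦ χ x • u x) μ :=
    (hu.integrable_smul_left_of_hasCompactSupport hχ.continuous hχc).locallyIntegrable
  have hχG (i : ι) : Integrable (fun x ↦ χ x • G i x + fderiv ℝ χ x (b i) • u x) μ :=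
    ((hG i).integrable_smul_left_of_hasCompactSupport hχ.continuous hχc).add
      (hu.integrable_smul_left_of_hasCompactSupport
        ((hχ.continuous_fderiv (by simp)).clm_apply continuous_const)
        (hχc.fderiv_apply (𝕜 := ℝ) (b i)))
  obtain ⟨C, hC⟩ := exists_eLpNorm_le_mul_sum_eLpNorm_weakLineDeriv (F := F) μ b hp
  have hfin : eLpNorm (fun x ↦ χ x • u x) p μ < ⊤ :=
    (hC _ _ hχu hχc.smul_right (fun i ↦ (hχG i).aestronglyMeasurable)
      fun i ↦ (h i).smul_contDiff hu (hG i) hχ).trans_lt <|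
      ENNReal.mul_lt_top ENNReal.coe_lt_top <|
        ENNReal.sum_lt_top.2 fun i _ ↦ (memLp_one_iff_integrable.2 (hχG i)).eLpNorm_lt_top
  refine ⟨hu.aestronglyMeasurable.restrict, ?_⟩
  refine (eLpNorm_mono_ae ?_).trans_lt ((eLpNorm_restrict_le _ _ _ K).trans_lt hfin)
  filter_upwards [ae_restrict_mem hK.measurableSet] with x hx
  rw [χ.one_of_mem_closedBall (hKR hx), one_smul]

end Mollification

section RemovableSingularity

section Limit

variable {E F : Type*} [NormedAddCommGroup E] [MeasurableSpace E] [NormedAddCommGroup F]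
  {μ : Measure E}

lemma locallyIntegrable_norm [SecondCountableTopology E] {f : E → F} (hf : LocallyIntegrable f μ) :
    LocallyIntegrable (fun x ↦ ‖f x‖) μ :=
  hf.mono hf.aestronglyMeasurable.norm (ae_of_all _ fun x ↦ (norm_norm (f x)).le)

variable [OpensMeasurableSpace E] [NormedSpace ℝ F]

lemma tendsto_integral_smul_of_locallyIntegrable_bound {f : ℕ → E → F} {g : E → F} {bound : E → ℝ}
    (hf : ∀ k, AEStronglyMeasurable (f k) μ) (hb : LocallyIntegrable bound μ)
    (hfb : ∀ k, ∀ᵐ x ∂μ, ‖f k x‖ ≤ bound x)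
    (hlim : ∀ᵐ x ∂μ, Tendsto (fun k ↦ f k x) atTop (𝓝 (g x))) {φ : E → ℝ} (hφ : Continuous φ)
    (hφc : HasCompactSupport φ) :
    Tendsto (fun k ↦ ∫ x, φ x • f k x ∂μ) atTop (𝓝 (∫ x, φ x • g x ∂μ)) := by
  refine tendsto_integral_of_dominated_convergence (fun x ↦ ‖φ x‖ • bound x)
    (fun k ↦ hφ.aestronglyMeasurable.smul (hf k))
    (hb.integrable_smul_left_of_hasCompactSupport hφ.norm hφc.norm) (fun k ↦ ?_)
    (hlim.mono fun x hx ↦ hx.const_smul (φ x))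
  filter_upwards [hfb k] with x hx
  rw [norm_smul, smul_eq_mul]
  gcongr

lemma IsWeakLineDeriv.of_tendsto [NormedSpace ℝ E] {u g : ℕ → E → F} {u' g' : E → F} {v : E}
    {U V : E → ℝ} (h : ∀ k, IsWeakLineDeriv μ (u k) v (g k))
    (hu : ∀ k, AEStronglyMeasurable (u k) μ) (hg : ∀ k, AEStronglyMeasurable (g k) μ)
    (hU : LocallyIntegrable U μ) (huU : ∀ k, ∀ᵐ x ∂μ, ‖u k x‖ ≤ U x)
    (hV : LocallyIntegrable V μ) (hgV : ∀ k, ∀ᵐ x ∂μ, ‖g k x‖ ≤ V x)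
    (hulim : ∀ᵐ x ∂μ, Tendsto (fun k ↦ u k x) atTop (𝓝 (u' x)))
    (hglim : ∀ᵐ x ∂μ, Tendsto (fun k ↦ g k x) atTop (𝓝 (g' x))) :
    IsWeakLineDeriv μ u' v g' := by
  intro φ hφ hφc
  refine tendsto_nhds_unique (tendsto_integral_smul_of_locallyIntegrable_bound hu hU huU hulim
    ((hφ.continuous_fderiv (by simp)).clm_apply continuous_const)
    (hφc.fderiv_apply (𝕜 := ℝ) v)) ?_
  simp only [h _ φ hφ hφc]
  exact (tendsto_integral_smul_of_locallyIntegrable_bound hg hV hgV hglim hφ.continuous hφc).neg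

end Limit

section PunctureCutoff

variable {E : Type*} [NormedAddCommGroup E] [NormedSpace ℝ E] [FiniteDimensional ℝ E]

/-- Smooth functions vanishing near `0` and equal to `1` outside `ball 0 (2 / (k + 1))`, used to cut
off a singularity at the origin as `k → ∞`. -/
noncomputable def punctureCutoff (k : ℕ) (x : E) : ℝ :=
  1 - (⟨1, 2, one_pos, one_lt_two⟩ : ContDiffBump (0 : E)) (((k : ℝ) + 1) • x)

lemma contDiff_punctureCutoff (k : ℕ) : ContDiff ℝ ∞ (punctureCutoff k : E → ℝ) :=
  contDiff_const.sub ((ContDiffBump.contDiff _).comp (contDiff_id.const_smul _))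

lemma norm_punctureCutoff_le_one (k : ℕ) (x : E) : ‖punctureCutoff k x‖ ≤ 1 := by
  rw [punctureCutoff, norm_of_nonneg (sub_nonneg.2 (ContDiffBump.le_one _))]
  exact sub_le_self _ (ContDiffBump.nonneg _)

lemma punctureCutoff_eventuallyEq_zero (k : ℕ) : (punctureCutoff k : E → ℝ) =ᶠ[𝓝 0] 0 := by
  have h : Tendsto (fun x : E ↦ ((k : ℝ) + 1) • x) (𝓝 0) (𝓝 0) := by
    simpa using (continuous_const_smul ((k : ℝ) + 1)).tendsto (0 : E)
  filter_upwards [h (ContDiffBump.eventuallyEq_one ⟨1, 2, one_pos, one_lt_two⟩)] with x hx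
  exact sub_eq_zero.2 (Eq.symm hx)

lemma eventually_punctureCutoff_eventuallyEq_one {x : E} (hx : x ≠ 0) :
    ∀ᶠ k in atTop, (punctureCutoff k : E → ℝ) =ᶠ[𝓝 x] 1 := by
  have hlarge : Tendsto (fun k : ℕ ↦ ((k : ℝ) + 1) * ‖x‖) atTop atTop :=
    (tendsto_atTop_add_const_right _ 1 tendsto_natCast_atTop_atTop).atTop_mul_const
      (norm_pos_iff.2 hx)
  filter_upwards [hlarge.eventually_gt_atTop 2] with k hk
  have hcont : Continuous fun y : E ↦ ((k : ℝ) + 1) * ‖y‖ := by fun_prop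
  filter_upwards [hcont.continuousAt.eventually_const_lt hk] with y hy
  have hdist : 2 ≤ dist (((k : ℝ) + 1) • y) 0 := by
    rw [dist_zero_right, norm_smul, norm_of_nonneg (by positivity)]
    exact hy.le
  have hzero := ContDiffBump.zero_of_le_dist (⟨1, 2, one_pos, one_lt_two⟩ : ContDiffBump (0 : E))
    hdist
  simp [punctureCutoff, hzero]

lemma exists_norm_fderiv_punctureCutoff_le (E : Type*) [NormedAddCommGroup E] [NormedSpace ℝ E]
    [FiniteDimensional ℝ E] :
    ∃ M, ∀ k, ∀ x : E, ‖x‖ * ‖fderiv ℝ (punctureCutoff k) x‖ ≤ M := by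
  let χ : ContDiffBump (0 : E) := ⟨1, 2, one_pos, one_lt_two⟩
  obtain ⟨M, hM⟩ := ((χ.hasCompactSupport.fderiv (𝕜 := ℝ)).smul_left
    (f := fun y : E ↦ ‖y‖)).exists_bound_of_continuous
    (continuous_norm.smul (χ.contDiff.continuous_fderiv one_ne_zero))
  refine ⟨M, fun k x ↦ ?_⟩
  have hderiv : fderiv ℝ (punctureCutoff k) x =
      -(((k : ℝ) + 1) • fderiv ℝ χ (((k : ℝ) + 1) • x)) := by
    rw [show punctureCutoff k = fun x : E ↦ 1 - χ (((k : ℝ) + 1) • x) from rfl, fderiv_const_sub,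
      fderiv_comp_smul]
  have hMx := hM (((k : ℝ) + 1) • x)
  rw [Pi.smul_apply', norm_smul, norm_norm, norm_smul] at hMx
  rw [hderiv, norm_neg, norm_smul]
  linarith

variable {F : Type*} [NormedAddCommGroup F] [NormedSpace ℝ F]

lemma hasLineDerivAt_punctureCutoff_smul {u g : E → F} {v : E}
    (h : ∀ x ≠ 0, HasLineDerivAt ℝ u (g x) x v) (k : ℕ) (x : E) :
    HasLineDerivAt ℝ (fun x ↦ punctureCutoff k x • u x)
      (punctureCutoff k x • g x + fderiv ℝ (punctureCutoff k) x v • u x) x v := by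
  rcases eq_or_ne x 0 with rfl | hx
  · have h0 := punctureCutoff_eventuallyEq_zero (E := E) k
    have hzero : (fun x ↦ punctureCutoff k x • u x) =ᶠ[𝓝 0] fun _ ↦ 0 := by
      filter_upwards [h0] with x hx
      simp [hx]
    simpa [h0.fderiv_eq, h0.eq_of_nhds] using
      ((hasFDerivAt_const (0 : F) (0 : E)).congr_of_eventuallyEq hzero).hasLineDerivAt v
  · have hη := ((contDiff_punctureCutoff (E := E) k).differentiable (by simp)
      x).hasFDerivAt.hasLineDerivAt v
    simpa [HasLineDerivAt] using HasDerivAt.fun_smul hη (h x hx)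

lemma norm_fderiv_punctureCutoff_smul_le {M : ℝ}
    (hM : ∀ k, ∀ x : E, ‖x‖ * ‖fderiv ℝ (punctureCutoff k) x‖ ≤ M) (k : ℕ) {x : E} (hx : x ≠ 0)
    (v : E) (y : F) :
    ‖fderiv ℝ (punctureCutoff k) x v • y‖ ≤ M * ‖v‖ * ‖‖x‖⁻¹ • y‖ := by
  have hx' := norm_pos_iff.2 hx
  have hη : ‖fderiv ℝ (punctureCutoff k) x‖ ≤ M * ‖x‖⁻¹ := by
    rw [← div_eq_mul_inv, le_div_iff₀' hx']
    exact hM k x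
  calc ‖fderiv ℝ (punctureCutoff k) x v • y‖ ≤ M * ‖x‖⁻¹ * ‖v‖ * ‖y‖ := by
        rw [norm_smul]
        gcongr
        exact (ContinuousLinearMap.le_opNorm _ v).trans (by gcongr)
    _ = M * ‖v‖ * ‖‖x‖⁻¹ • y‖ := by
        rw [norm_smul, norm_inv, norm_norm]
        ring

end PunctureCutoff

variable {E F : Type*} [NormedAddCommGroup E] [NormedSpace ℝ E] [FiniteDimensional ℝ E]
  [MeasurableSpace E] [BorelSpace E] [NormedAddCommGroup F] [NormedSpace ℝ F]
  {μ : Measure E} [μ.IsAddHaarMeasure] {u g : E → F} {v : E}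

lemma isWeakLineDeriv_of_hasLineDerivAt (hu : LocallyIntegrable u μ) (hg : LocallyIntegrable g μ)
    (h : ∀ x, HasLineDerivAt ℝ u (g x) x v) : IsWeakLineDeriv μ u v g := by
  intro φ hφ hφc
  have hφ' : Continuous fun x ↦ fderiv ℝ φ x v :=
    (hφ.continuous_fderiv (by simp)).clm_apply continuous_const
  rw [eq_neg_iff_add_eq_zero, add_comm, ← eq_neg_iff_add_eq_zero]
  exact integral_bilinear_hasLineDerivAt_right_eq_neg_left_of_integrable
    (B := ContinuousLinearMap.lsmul ℝ ℝ)
    (hu.integrable_smul_left_of_hasCompactSupport hφ' (hφc.fderiv_apply (𝕜 := ℝ) v))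
    (hg.integrable_smul_left_of_hasCompactSupport hφ.continuous hφc)
    (hu.integrable_smul_left_of_hasCompactSupport hφ.continuous hφc)
    (fun x _ ↦ ((hφ.differentiable (by simp) x).hasFDerivAt.hasLineDerivAt v)) fun x _ ↦ h x

lemma isWeakLineDeriv_of_hasLineDerivAt_of_ne_zero [Nontrivial E] (hu : LocallyIntegrable u μ)
    (hu' : LocallyIntegrable (fun x ↦ ‖x‖⁻¹ • u x) μ) (hg : LocallyIntegrable g μ)
    (h : ∀ x ≠ 0, HasLineDerivAt ℝ u (g x) x v) : IsWeakLineDeriv μ u v g := by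
  obtain ⟨M, hM⟩ := exists_norm_fderiv_punctureCutoff_le E
  have hne : ∀ᵐ x ∂μ, x ≠ 0 := by simp [ae_iff]
  let uk (k : ℕ) (x : E) : F := punctureCutoff k x • u x
  let gk (k : ℕ) (x : E) : F := punctureCutoff k x • g x + fderiv ℝ (punctureCutoff k) x v • u x
  let V (x : E) : ℝ := ‖g x‖ + M * ‖v‖ * ‖‖x‖⁻¹ • u x‖
  have hη (k : ℕ) : ContDiff ℝ ∞ (punctureCutoff k : E → ℝ) := contDiff_punctureCutoff k
  have hη' (k : ℕ) : Continuous fun x : E ↦ fderiv ℝ (punctureCutoff k) x v :=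
    ((hη k).continuous_fderiv (by simp)).clm_apply continuous_const
  have huk (k : ℕ) : AEStronglyMeasurable (uk k) μ :=
    (hη k).continuous.aestronglyMeasurable.smul hu.aestronglyMeasurable
  have hgk (k : ℕ) : AEStronglyMeasurable (gk k) μ :=
    ((hη k).continuous.aestronglyMeasurable.smul hg.aestronglyMeasurable).add
      ((hη' k).aestronglyMeasurable.smul hu.aestronglyMeasurable)
  have hV : LocallyIntegrable V μ := (locallyIntegrable_norm hg).add
    ((locallyIntegrable_norm hu').smul (M * ‖v‖))
  have hbound (k : ℕ) (x : E) (y : F) : ‖punctureCutoff k x • y‖ ≤ ‖y‖ := by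
    rw [norm_smul]
    exact mul_le_of_le_one_left (norm_nonneg _) (norm_punctureCutoff_le_one k x)
  have hgV (k : ℕ) : ∀ᵐ x ∂μ, ‖gk k x‖ ≤ V x := hne.mono fun x hx ↦
    (norm_add_le _ _).trans (add_le_add (hbound k x _)
      (norm_fderiv_punctureCutoff_smul_le hM k hx v _))
  have hweak (k : ℕ) : IsWeakLineDeriv μ (uk k) v (gk k) :=
    isWeakLineDeriv_of_hasLineDerivAt (hu.mono (huk k) (ae_of_all _ fun x ↦ hbound k x _))
      (hV.mono (hgk k) ((hgV k).mono fun x hx ↦ hx.trans (le_abs_self _)))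
      (hasLineDerivAt_punctureCutoff_smul h k)
  refine .of_tendsto hweak huk hgk (locallyIntegrable_norm hu)
    (fun k ↦ ae_of_all _ fun x ↦ hbound k x _) hV hgV
    (hne.mono fun x hx ↦ tendsto_const_nhds.congr' ?_)
    (hne.mono fun x hx ↦ tendsto_const_nhds.congr' ?_)
  all_goals filter_upwards [eventually_punctureCutoff_eventuallyEq_one hx] with k hk
  · simp [uk, hk.eq_of_nhds]
  · simp [gk, hk.eq_of_nhds, hk.fderiv_eq]

end RemovableSingularity

section HausdorffSphere

lemma finrank_orthogonal_span_singleton_eq_sub_one {E : Type*} [NormedAddCommGroup E]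
    [InnerProductSpace ℝ E] [FiniteDimensional ℝ E] {x : E} (hx : x ≠ 0) :
    (finrank ℝ (ℝ ∙ x)ᗮ : ℝ) = finrank ℝ E - 1 := by
  have h := Submodule.finrank_add_finrank_orthogonal (ℝ ∙ x)
  rw [finrank_span_singleton hx] at h
  rw [← h]
  push_cast
  ring

variable {E : Type*} [NormedAddCommGroup E] [MeasurableSpace E] [BorelSpace E]

open scoped Pointwise in
lemma hausdorffMeasure_sphere [NormedSpace ℝ E] {d : ℝ} (hd : 0 ≤ d) (x : E) {r : ℝ} (hr : 0 < r) :
    μH[d] (sphere x r) = ENNReal.ofReal (r ^ d) * μH[d] (sphere (0 : E) 1) := by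
  have himage : x +ᵥ r • sphere (0 : E) 1 = sphere x r := by
    rw [smul_sphere' hr.ne', vadd_sphere]
    simp [abs_of_pos hr]
  rw [← himage, hausdorffMeasure_vadd _ (.inl hd), Measure.hausdorffMeasure_smul₀ hd hr.ne',
    ENNReal.smul_def, smul_eq_mul, ENNReal.coe_rpow_of_nonneg _ hd, ← enorm_eq_nnnorm,
    enorm_of_nonneg hr.le, ENNReal.ofReal_rpow_of_pos hr]

variable [InnerProductSpace ℝ E] [FiniteDimensional ℝ E]

lemma hausdorffMeasure_unit_sphere_lt_top :
    μH[(finrank ℝ E : ℝ) - 1] (sphere (0 : E) 1) < ⊤ := by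
  refine (isCompact_sphere 0 1).measure_lt_top_of_nhdsWithin fun e he ↦ ?_
  have hv : ‖-e‖ = 1 := by simpa using he
  have hv0 : -e ≠ 0 := norm_pos_iff.1 (hv ▸ one_pos)
  let f : (ℝ ∙ -e)ᗮ → E := fun w ↦ stereoInvFun hv w
  have hf : ContDiff ℝ 1 f := contDiff_stereoInvFunAux.comp (ℝ ∙ -e)ᗮ.subtypeL.contDiff
  have hf0 : f 0 = e := by simp [f]
  obtain ⟨K, t, ht, hK⟩ := hf.contDiffAt.exists_lipschitzOnWith (x := 0)
  refine ⟨f '' (t ∩ ball 0 1), ?_, ?_⟩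
  · have hmap : map f (𝓝 0) = 𝓝[sphere 0 1] e := by
      have hopen := (isOpenEmbedding_stereographic_symm hv).map_nhds_eq 0
      have he0 : (stereographic hv).symm 0 = ⟨e, he⟩ := Subtype.ext hf0
      rw [nhdsWithin_eq_map_subtype_coe he, ← he0, ← hopen, map_map]
      rfl
    exact hmap ▸ image_mem_map (inter_mem ht (ball_mem_nhds _ one_pos))
  · rw [← finrank_orthogonal_span_singleton_eq_sub_one hv0]
    refine ((hK.mono inter_subset_left).hausdorffMeasure_image_le (Nat.cast_nonneg _)).trans_lt ?_
    exact ENNReal.mul_lt_top (ENNReal.rpow_lt_top_of_nonneg (Nat.cast_nonneg _) (by simp))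
      ((measure_mono inter_subset_right).trans_lt isBounded_ball.measure_lt_top)

lemma hausdorffMeasure_ball_eq_of_finrank_eq {F : Type*} [NormedAddCommGroup F]
    [InnerProductSpace ℝ F] [FiniteDimensional ℝ F] [MeasurableSpace F] [BorelSpace F]
    (h : finrank ℝ E = finrank ℝ F) (d r : ℝ) :
    μH[d] (ball (0 : E) r) = μH[d] (ball (0 : F) r) := by
  let f : E ≃ₗᵢ[ℝ] F := (stdOrthonormalBasis ℝ E).equiv (stdOrthonormalBasis ℝ F) (finCongr h)
  rw [← f.toIsometryEquiv.hausdorffMeasure_image d (ball 0 r)]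
  congr 1
  simp

end HausdorffSphere

section NearCap

lemma setLIntegral_image_hausdorffMeasure_le {X Y : Type*} [MetricSpace X] [MeasurableSpace X]
    [BorelSpace X] [MetricSpace Y] [MeasurableSpace Y] [BorelSpace Y] {d : ℝ} (hd : 0 ≤ d)
    {Q : X → Y} (hQ : LipschitzWith 1 Q) (S : Set X) {g : Y → ℝ≥0∞} (hg : Measurable g) :
    ∫⁻ y in Q '' S, g y ∂μH[d] ≤ ∫⁻ z in S, g (Q z) ∂μH[d] := by
  have hQm := hQ.continuous.measurable
  have hle : (μH[d]).restrict (Q '' S) ≤ ((μH[d]).restrict S).map Q := by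
    refine Measure.le_iff.2 fun D hD ↦ ?_
    rw [Measure.map_apply hQm hD, Measure.restrict_apply hD, Measure.restrict_apply (hQm hD),
      ← image_preimage_inter]
    simpa using hQ.hausdorffMeasure_image_le hd (Q ⁻¹' D ∩ S)
  exact (lintegral_mono' hle le_rfl).trans_eq (lintegral_map hg hQm)

variable {E : Type*} [NormedAddCommGroup E] [InnerProductSpace ℝ E]

lemma exists_mem_sphere_orthogonalProjectionOnto_eq {x : E} (hx : x ≠ 0) {y : (ℝ ∙ x)ᗮ}
    (hy : ‖y‖ ≤ ‖x‖) :
    ∃ z ∈ sphere x ‖x‖, (ℝ ∙ x)ᗮ.orthogonalProjectionOnto z = y ∧ ‖z‖ ≤ 2 * ‖y‖ := by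
  have hx' := norm_pos_iff.2 hx
  set c := √(‖x‖ ^ 2 - ‖y‖ ^ 2) / ‖x‖ with hc
  have hsq : (c * ‖x‖) ^ 2 = ‖x‖ ^ 2 - ‖y‖ ^ 2 := by
    rw [hc, div_mul_cancel₀ _ hx'.ne', sq_sqrt (sub_nonneg.2 (by gcongr))]
  have hc0 : 0 ≤ c := by positivity
  have hc_le : c * ‖x‖ ≤ ‖x‖ := le_of_sq_le_sq (by nlinarith) hx'.le
  have hc_ge : ‖x‖ - ‖y‖ ≤ c * ‖x‖ := le_of_sq_le_sq (by nlinarith [norm_nonneg y]) (by positivity)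
  have hyx : inner ℝ (y : E) (-c • x) = 0 := by
    rw [inner_smul_right, Submodule.mem_orthogonal_singleton_iff_inner_left.1 y.2, mul_zero]
  refine ⟨y + (1 - c) • x, ?_, ?_, ?_⟩
  · have hpyth := norm_add_sq_eq_norm_sq_add_norm_sq_of_inner_eq_zero _ _ hyx
    rw [mem_sphere_iff_norm, ← sq_eq_sq₀ (norm_nonneg _) hx'.le,
      show (y : E) + (1 - c) • x - x = y + -c • x by module, sq, hpyth, norm_smul, norm_neg,
      norm_of_nonneg hc0, ← sq (c * ‖x‖), hsq, Submodule.coe_norm]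
    ring
  · simp [Submodule.orthogonalProjectionOnto_orthogonalComplement_singleton_eq_zero]
  · calc ‖(y : E) + (1 - c) • x‖ ≤ ‖(y : E)‖ + (1 - c) * ‖x‖ := by
          refine (norm_add_le _ _).trans_eq ?_
          rw [norm_smul, norm_of_nonneg (by nlinarith)]
      _ ≤ 2 * ‖y‖ := by
          rw [Submodule.coe_norm] at hc_ge ⊢
          linarith

variable [MeasurableSpace E] [BorelSpace E]

lemma setLIntegral_ball_orthogonal_le_setLIntegral_sphere {d : ℝ} (hd : 0 ≤ d) {x : E}
    (hx : x ≠ 0) {h : ℝ → ℝ≥0∞} (hh : Measurable h) {f : E → ℝ≥0∞}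
    (hf : ∀ a < ‖x‖ / 2, ∀ z : E, a ≤ ‖z‖ → ‖z‖ ≤ 2 * a → h a ≤ f z) :
    ∫⁻ y in ball (0 : (ℝ ∙ x)ᗮ) (‖x‖ / 2), h ‖y‖ ∂μH[d] ≤ ∫⁻ z in sphere x ‖x‖, f z ∂μH[d] := by
  set Q := (ℝ ∙ x)ᗮ.orthogonalProjectionOnto
  have hQ : LipschitzWith 1 Q := (ℝ ∙ x)ᗮ.lipschitzWith_orthogonalProjectionOnto
  let cap : Set E := {z | z ∈ sphere x ‖x‖ ∧ ‖Q z‖ < ‖x‖ / 2 ∧ ‖z‖ ≤ 2 * ‖Q z‖}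
  have hsmall : IsOpen {z | ‖Q z‖ < ‖x‖ / 2} := isOpen_lt (by fun_prop) continuous_const
  have hnear : IsClosed {z | ‖z‖ ≤ 2 * ‖Q z‖} := isClosed_le continuous_norm (by fun_prop)
  have hcap : MeasurableSet cap := isClosed_sphere.measurableSet.inter
    (hsmall.measurableSet.inter hnear.measurableSet)
  have hball : ball (0 : (ℝ ∙ x)ᗮ) (‖x‖ / 2) ⊆ Q '' cap := fun y hy ↦ by
    rw [mem_ball_zero_iff] at hy
    obtain ⟨z, hz, rfl, hzy⟩ :=
      exists_mem_sphere_orthogonalProjectionOnto_eq hx (y := y) (by linarith [norm_nonneg x])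
    exact ⟨z, ⟨hz, hy, hzy⟩, rfl⟩
  calc ∫⁻ y in ball (0 : (ℝ ∙ x)ᗮ) (‖x‖ / 2), h ‖y‖ ∂μH[d]
      ≤ ∫⁻ y in Q '' cap, h ‖y‖ ∂μH[d] := lintegral_mono_set hball
    _ ≤ ∫⁻ z in cap, h ‖Q z‖ ∂μH[d] :=
        setLIntegral_image_hausdorffMeasure_le hd hQ cap (by fun_prop)
    _ ≤ ∫⁻ z in cap, f z ∂μH[d] := setLIntegral_mono' hcap fun z hz ↦
        hf _ hz.2.1 z (Submodule.norm_orthogonalProjectionOnto_apply_le _ z) hz.2.2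
    _ ≤ ∫⁻ z in sphere x ‖x‖, f z ∂μH[d] := lintegral_mono_set fun z hz ↦ hz.1

end NearCap

section SphericalAverage

variable {n : ℕ}

lemma rpow_mul_log_le_radialLog {α : ℝ} (hα : 0 ≤ α) (hn : 1 ≤ n) {a : ℝ} (ha : 0 < a)
    {z : EuclideanSpace ℝ (Fin n)} (haz : a ≤ ‖z‖) (hza : ‖z‖ ≤ 2 * a) (hz : ‖z‖ ≤ 1) :
    (2 : ℝ) ^ (1 - (n : ℝ)) * (a ^ (1 - (n : ℝ)) * log (exp 1 / a) ^ (-α)) ≤ radialLog α z := by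
  have hz0 : 0 < ‖z‖ := ha.trans_le haz
  have hlog := one_le_log_exp_one_div hz0 hz
  have hn' : (1 : ℝ) ≤ n := by exact_mod_cast hn
  have hlog' : log (exp 1 / ‖z‖) ≤ log (exp 1 / a) :=
    log_le_log (by positivity) (by gcongr)
  rw [radialLog, ← mul_assoc, ← mul_rpow zero_le_two ha.le]
  refine mul_le_mul ?_ ?_ (rpow_nonneg (by linarith) _) (by positivity)
  · exact rpow_le_rpow_of_nonpos hz0 hza (by linarith)
  · exact rpow_le_rpow_of_nonpos (by linarith) hlog' (by linarith)

lemma log_exp_one_div_half_le {r : ℝ} (hr : 0 < r) (hr1 : r ≤ 1) :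
    log (exp 1 / (r / 2)) ≤ 2 * log (exp 1 / r) := by
  have hlog := one_le_log_exp_one_div hr hr1
  rw [show exp 1 / (r / 2) = 2 * (exp 1 / r) by field_simp, log_mul two_ne_zero (by positivity)]
  linarith [log_two_lt_d9]

lemma setLIntegral_ball_orthogonal_norm_rpow_mul_log (hn : 2 ≤ n) {β ρ : ℝ} (hβ : 0 < β)
    (h0 : 0 ≤ ρ) (hρ : ρ < exp 1) {x : EuclideanSpace ℝ (Fin n)} (hx : x ≠ 0) :
    ∫⁻ y in ball (0 : (ℝ ∙ x)ᗮ) ρ, ENNReal.ofReal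
        (‖y‖ ^ (1 - (n : ℝ)) * log (exp 1 / ‖y‖) ^ (-(1 + β))) ∂μH[(n : ℝ) - 1] =
      ENNReal.ofReal (((n : ℝ) - 1) *
        (μH[(n : ℝ) - 1] : Measure (EuclideanSpace ℝ (Fin (n - 1)))).real (ball 0 1) *
        (β⁻¹ * log (exp 1 / ρ) ^ (-β))) := by
  have hdim : (finrank ℝ (ℝ ∙ x)ᗮ : ℝ) = (n : ℝ) - 1 := by
    simpa using finrank_orthogonal_span_singleton_eq_sub_one hx
  have hdim' : finrank ℝ (ℝ ∙ x)ᗮ = n - 1 := by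
    rw [← Nat.cast_pred (by omega)] at hdim
    exact_mod_cast hdim
  have : Nontrivial (ℝ ∙ x)ᗮ := nontrivial_of_finrank_pos (R := ℝ) (by omega)
  have h := setLIntegral_ball_norm_rpow_mul_log
    (μH[finrank ℝ (ℝ ∙ x)ᗮ] : Measure (ℝ ∙ x)ᗮ) hβ h0 hρ
  rwa [measureReal_def, hausdorffMeasure_ball_eq_of_finrank_eq
    (F := EuclideanSpace ℝ (Fin (n - 1))) (by simpa using hdim'), ← measureReal_def, hdim,
    neg_sub] at h

lemma setLIntegral_ball_orthogonal_le_setLIntegral_sphere_of_eq_radialLog (hn : 2 ≤ n) {α : ℝ}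
    (hα : 0 ≤ α) {u : EuclideanSpace ℝ (Fin n) → ℝ}
    (hu : ∀ x, 0 < ‖x‖ → ‖x‖ < 1 → u x = radialLog α x) {x : EuclideanSpace ℝ (Fin n)}
    (hx : x ≠ 0) (hx1 : ‖x‖ ≤ 1) :
    ENNReal.ofReal (2 ^ (1 - (n : ℝ))) * ∫⁻ y in ball (0 : (ℝ ∙ x)ᗮ) (‖x‖ / 2), ENNReal.ofReal
        (‖y‖ ^ (1 - (n : ℝ)) * log (exp 1 / ‖y‖) ^ (-α)) ∂μH[(n : ℝ) - 1] ≤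
      ∫⁻ z in sphere x ‖x‖, ‖u z‖ₑ ∂μH[(n : ℝ) - 1] := by
  have hn1 : (0 : ℝ) < (n : ℝ) - 1 := sub_pos.2 (by exact_mod_cast hn)
  rw [← lintegral_const_mul _ (by fun_prop)]
  refine setLIntegral_ball_orthogonal_le_setLIntegral_sphere hn1.le hx (h := fun s ↦
    ENNReal.ofReal (2 ^ (1 - (n : ℝ))) *
      ENNReal.ofReal (s ^ (1 - (n : ℝ)) * log (exp 1 / s) ^ (-α))) (by fun_prop)
    fun s hs z hsz hzs ↦ ?_
  rcases (by linarith [norm_nonneg z] : 0 ≤ s).eq_or_lt with rfl | hs0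
  · simp [zero_rpow (x := 1 - (n : ℝ)) (by linarith)]
  rw [hu z (hs0.trans_le hsz) (by linarith), ← ENNReal.ofReal_mul (by positivity)]
  exact (ENNReal.ofReal_le_ofReal (rpow_mul_log_le_radialLog hα (by omega) hs0 hsz hzs
    (by linarith))).trans (ofReal_le_enorm _)

lemma exists_le_setLIntegral_sphere (hn : 2 ≤ n) {β : ℝ} (hβ : 0 < β) :
    ∃ c : ℝ, 0 < c ∧ ∀ u : EuclideanSpace ℝ (Fin n) → ℝ,
      (∀ x, 0 < ‖x‖ → ‖x‖ < 1 → u x = radialLog (1 + β) x) →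
      ∀ x, 0 < ‖x‖ → ‖x‖ ≤ 1 → ENNReal.ofReal (c * log (exp 1 / ‖x‖) ^ (-β)) ≤
        ∫⁻ z in sphere x ‖x‖, ‖u z‖ₑ ∂μH[(n : ℝ) - 1] := by
  have hn1 : (0 : ℝ) < (n : ℝ) - 1 := sub_pos.2 (by exact_mod_cast hn)
  set κ := (μH[(n : ℝ) - 1] : Measure (EuclideanSpace ℝ (Fin (n - 1)))).real (ball 0 1) with hκ
  have hκ0 : 0 < κ := by
    rw [hκ, ← Nat.cast_pred (by omega), ← finrank_euclideanSpace_fin (𝕜 := ℝ) (n := n - 1)]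
    exact ENNReal.toReal_pos (measure_ball_pos _ _ one_pos).ne' isBounded_ball.measure_lt_top.ne
  set a := (2 : ℝ) ^ (1 - (n : ℝ))
  refine ⟨a * (((n : ℝ) - 1) * κ * (β⁻¹ * 2 ^ (-β))), by positivity, fun u hu x hx hx1 ↦ ?_⟩
  have hlog := one_le_log_exp_one_div hx hx1
  have he : ‖x‖ / 2 < exp 1 := by linarith [one_lt_exp_iff.2 one_pos]
  refine le_trans ?_ (setLIntegral_ball_orthogonal_le_setLIntegral_sphere_of_eq_radialLog hn
    (by positivity) hu (norm_pos_iff.1 hx) hx1)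
  rw [setLIntegral_ball_orthogonal_norm_rpow_mul_log hn hβ (by positivity) he (norm_pos_iff.1 hx),
    ← ENNReal.ofReal_mul (by positivity)]
  refine ENNReal.ofReal_le_ofReal ?_
  calc a * (((n : ℝ) - 1) * κ * (β⁻¹ * 2 ^ (-β))) * log (exp 1 / ‖x‖) ^ (-β)
      = a * (((n : ℝ) - 1) * κ * (β⁻¹ * (2 * log (exp 1 / ‖x‖)) ^ (-β))) := by
        rw [mul_rpow zero_le_two (by linarith)]
        ring
    _ ≤ a * (((n : ℝ) - 1) * κ * (β⁻¹ * log (exp 1 / (‖x‖ / 2)) ^ (-β))) := by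
        gcongr a * (_ * (_ * ?_))
        exact rpow_le_rpow_of_nonpos (log_exp_one_div_pos (by positivity) he)
          (log_exp_one_div_half_le hx hx1) (by linarith)

lemma exists_le_sphericalAverage (hn : 2 ≤ n) {β : ℝ} (hβ : 0 < β) :
    ∃ C : ℝ, 0 < C ∧ ∀ u : EuclideanSpace ℝ (Fin n) → ℝ,
      (∀ x, 0 < ‖x‖ → ‖x‖ < 1 → u x = radialLog (1 + β) x) →
      ∀ x, 0 < ‖x‖ → ‖x‖ ≤ 1 →
        ENNReal.ofReal (C * radialLog β x) ≤ sphericalAverage u x ‖x‖ := by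
  obtain ⟨c, hc, hcu⟩ := exists_le_setLIntegral_sphere hn hβ
  set A := μH[(n : ℝ) - 1] (sphere (0 : EuclideanSpace ℝ (Fin n)) 1)
  have hA : A < ⊤ := by
    simpa using hausdorffMeasure_unit_sphere_lt_top (E := EuclideanSpace ℝ (Fin n))
  have hn' : (0 : ℝ) ≤ (n : ℝ) - 1 := by
    rw [sub_nonneg]
    exact_mod_cast one_le_two.trans hn
  refine ⟨c / (A.toReal + 1), by positivity, fun u hu x hx hx1 ↦ ?_⟩
  have hsphere : μH[(n : ℝ) - 1] (sphere x ‖x‖) ≤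
      ENNReal.ofReal (‖x‖ ^ ((n : ℝ) - 1) * (A.toReal + 1)) := by
    rw [hausdorffMeasure_sphere hn' x hx, ENNReal.ofReal_mul (by positivity)]
    gcongr
    exact (ENNReal.ofReal_toReal hA.ne).ge.trans (ENNReal.ofReal_le_ofReal (by linarith))
  calc ENNReal.ofReal (c / (A.toReal + 1) * radialLog β x)
      = ENNReal.ofReal (c * log (exp 1 / ‖x‖) ^ (-β)) /
          ENNReal.ofReal (‖x‖ ^ ((n : ℝ) - 1) * (A.toReal + 1)) := by
        rw [← ENNReal.ofReal_div_of_pos (by positivity), radialLog, ← neg_sub (n : ℝ) 1,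
          rpow_neg hx.le]
        congr 1
        field_simp
    _ ≤ (∫⁻ z in sphere x ‖x‖, ‖u z‖ₑ ∂μH[(n : ℝ) - 1]) / μH[(n : ℝ) - 1] (sphere x ‖x‖) :=
        ENNReal.div_le_div (hcu u hu x hx hx1) hsphere
    _ = sphericalAverage u x ‖x‖ := (setLAverage_eq _ _ _).symm

end SphericalAverage

section GradientOffOrigin

lemma gradient_apply {n : ℕ} (u : EuclideanSpace ℝ (Fin n) → ℝ) (x : EuclideanSpace ℝ (Fin n))
    (i : Fin n) : gradient u x i = fderiv ℝ u x (EuclideanSpace.single i 1) := by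
  rw [← inner_gradient_left, EuclideanSpace.inner_single_right]
  simp

lemma locallyIntegrable_apply {n : ℕ}
    {G : EuclideanSpace ℝ (Fin n) → EuclideanSpace ℝ (Fin n)} (hG : LocallyIntegrable G)
    (i : Fin n) :
    LocallyIntegrable fun x ↦ G x i :=
  hG.mono ((EuclideanSpace.proj i).continuous.comp_aestronglyMeasurable hG.aestronglyMeasurable)
    (ae_of_all _ fun _ ↦ PiLp.norm_apply_le _ i)

lemma isWeakGradient_gradient {n : ℕ} [Nontrivial (EuclideanSpace ℝ (Fin n))]
    {u : EuclideanSpace ℝ (Fin n) → ℝ} (hd : ∀ x ≠ 0, DifferentiableAt ℝ u x)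
    (hu : LocallyIntegrable u) (hu' : LocallyIntegrable fun x ↦ ‖x‖⁻¹ * u x)
    (hG : LocallyIntegrable (gradient u)) : IsWeakGradient u (gradient u) := by
  refine isWeakGradient_iff_isWeakLineDeriv.2 fun i ↦
    isWeakLineDeriv_of_hasLineDerivAt_of_ne_zero hu hu' (locallyIntegrable_apply hG i) fun x hx ↦ ?_
  rw [gradient_apply]
  exact (hd x hx).hasFDerivAt.hasLineDerivAt _

lemma integrable_of_norm_le_rpow_mul_log {E F : Type*} [NormedAddCommGroup E] [NormedSpace ℝ E]
    [FiniteDimensional ℝ E] [Nontrivial E] [MeasurableSpace E] [BorelSpace E] {μ : Measure E}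
    [μ.IsAddHaarMeasure] [NormedAddCommGroup F] {w : E → F} (hw : ContinuousOn w {0}ᶜ)
    (hc : HasCompactSupport w) {β M : ℝ} (hβ : 0 < β)
    (hM : ∀ x, 0 < ‖x‖ → ‖x‖ < 1 →
      ‖w x‖ ≤ M * (‖x‖ ^ (-(finrank ℝ E : ℝ)) * log (exp 1 / ‖x‖) ^ (-(1 + β)))) :
    Integrable w μ := by
  have hne : ∀ᵐ x ∂μ, x ≠ 0 := by simp [ae_iff]
  have hm : AEStronglyMeasurable w μ := by
    simpa using hw.aestronglyMeasurable (μ := μ) (measurableSet_singleton _).compl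
  have hball : IntegrableOn w (ball 0 1) μ := by
    refine ((integrableOn_ball_norm_rpow_mul_log μ hβ (by simp)).const_mul M).mono' hm.restrict ?_
    refine (ae_restrict_iff' measurableSet_ball).2 (hne.mono fun x hx hx1 ↦ ?_)
    exact hM x (norm_pos_iff.2 hx) (mem_ball_zero_iff.1 hx1)
  have hdiff : IntegrableOn w (tsupport w \ ball 0 1) μ := by
    refine (hw.mono fun _ hx ↦ ?_).integrableOn_compact (hc.diff isOpen_ball)
    exact (ne_of_mem_of_not_mem (mem_ball_self one_pos) hx.2).symm
  refine (integrableOn_iff_integrable_of_support_subset ?_).1 (hball.union hdiff)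
  rw [union_sdiff_self]
  exact (subset_tsupport w).trans subset_union_right

lemma norm_fderiv_comp_norm_le {E : Type*} [NormedAddCommGroup E] [InnerProductSpace ℝ E]
    {f : ℝ → ℝ} {f' : ℝ} {x : E} (hx : x ≠ 0) (hf : HasDerivAt f f' ‖x‖) :
    ‖fderiv ℝ (fun y ↦ f ‖y‖) x‖ ≤ ‖f'‖ := by
  have hnorm : DifferentiableAt ℝ (fun y : E ↦ ‖y‖) x :=
    (contDiffAt_norm ℝ hx).differentiableAt one_ne_zero
  have hcomp : HasFDerivAt (fun y ↦ f ‖y‖) _ x := hf.comp_hasFDerivAt x hnorm.hasFDerivAt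
  rw [hcomp.fderiv, norm_smul]
  refine mul_le_of_le_one_right (norm_nonneg _) ?_
  simpa using norm_fderiv_le_of_lipschitz ℝ (x₀ := x) lipschitzWith_one_norm

lemma hasDerivAt_rpow_mul_log_rpow (d α : ℝ) {s : ℝ} (hs : 0 < s) (hs1 : s < exp 1) :
    HasDerivAt (fun s ↦ s ^ (1 - d) * log (exp 1 / s) ^ (-α))
      (s ^ (-d) * ((1 - d) * log (exp 1 / s) ^ (-α) + α * log (exp 1 / s) ^ (-(1 + α)))) s := by
  convert! (hasDerivAt_rpow_const (p := 1 - d) (Or.inl hs.ne')).mul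
    (hasDerivAt_log_exp_one_div_rpow α hs hs1) using 1
  rw [sub_sub_cancel_left, sub_eq_neg_add, rpow_add_one hs.ne']
  field_simp

variable {n : ℕ}

lemma norm_fderiv_radialLog_le (hn : 1 ≤ n) {α : ℝ} (hα : 0 ≤ α) {x : EuclideanSpace ℝ (Fin n)}
    (hx : 0 < ‖x‖) (hx1 : ‖x‖ ≤ 1) :
    ‖fderiv ℝ (radialLog α) x‖ ≤
      ((n : ℝ) - 1 + α) * (‖x‖ ^ (-(n : ℝ)) * log (exp 1 / ‖x‖) ^ (-α)) := by
  have hlog := one_le_log_exp_one_div hx hx1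
  have hn' : (0 : ℝ) ≤ n - 1 := sub_nonneg.2 (by exact_mod_cast hn)
  refine (norm_fderiv_comp_norm_le (norm_pos_iff.1 hx) (hasDerivAt_rpow_mul_log_rpow n α hx
    (hx1.trans_lt (by simp)))).trans ?_
  set L := log (exp 1 / ‖x‖)
  have hL : 0 ≤ L ^ (-α) := rpow_nonneg (by linarith) _
  have hpow : L ^ (-(1 + α)) ≤ L ^ (-α) := rpow_le_rpow_of_exponent_le hlog (by linarith)
  calc ‖‖x‖ ^ (-(n : ℝ)) * ((1 - n) * L ^ (-α) + α * L ^ (-(1 + α)))‖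
      = ‖x‖ ^ (-(n : ℝ)) * ‖-((n - 1) * L ^ (-α)) + α * L ^ (-(1 + α))‖ := by
        rw [norm_mul, norm_of_nonneg (by positivity), ← neg_mul, neg_sub]
    _ ≤ ‖x‖ ^ (-(n : ℝ)) * ((n - 1) * L ^ (-α) + α * L ^ (-(1 + α))) := by
        gcongr
        refine (norm_add_le _ _).trans_eq ?_
        rw [norm_neg, norm_of_nonneg (mul_nonneg hn' hL),
          norm_of_nonneg (mul_nonneg hα (rpow_nonneg (by linarith) _))]
    _ ≤ ‖x‖ ^ (-(n : ℝ)) * ((n - 1) * L ^ (-α) + α * L ^ (-α)) := by gcongr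
    _ = (n - 1 + α) * (‖x‖ ^ (-(n : ℝ)) * L ^ (-α)) := by ring

lemma contDiffAt_radialLog (α : ℝ) {x : EuclideanSpace ℝ (Fin n)} (hx : x ≠ 0)
    (hx1 : ‖x‖ < exp 1) : ContDiffAt ℝ ∞ (radialLog α) x := by
  have hx0 := norm_pos_iff.2 hx
  have hnorm : ContDiffAt ℝ ∞ (fun x : EuclideanSpace ℝ (Fin n) ↦ ‖x‖) x := contDiffAt_norm ℝ hx
  exact (hnorm.rpow_const_of_ne hx0.ne').mul
    (((contDiffAt_const.div hnorm hx0.ne').log (div_pos (exp_pos 1) hx0).ne').rpow_const_of_ne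
      (log_exp_one_div_pos hx0 hx1).ne')

end GradientOffOrigin

section SmoothExtension

variable {n : ℕ}

lemma exists_nonneg_isSmoothExtension :
    ∃ u : EuclideanSpace ℝ (Fin n) → ℝ, (∀ x, 0 ≤ u x) ∧ IsSmoothExtension u := by
  let χ : ContDiffBump (0 : EuclideanSpace ℝ (Fin n)) := ⟨1, 2, one_pos, one_lt_two⟩
  have hχ {x} (hx : 2 ≤ ‖x‖) : χ x = 0 := χ.zero_of_le_dist (by simpa [χ] using hx)
  have he : (2 : ℝ) < exp 1 := by linarith [exp_one_gt_d9]
  refine ⟨fun x ↦ χ x * radialLog (1 + ((n : ℝ) - 1) / n) x, fun x ↦ ?_, fun x _ hx1 ↦ ?_,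
    fun x hx ↦ ContDiffAt.contDiffWithinAt ?_, χ.hasCompactSupport.mul_right⟩
  · rcases le_or_gt 2 ‖x‖ with h | h
    · simp [hχ h]
    · exact mul_nonneg χ.nonneg (radialLog_nonneg _ (h.trans he).le)
  · rw [χ.one_of_mem_closedBall (by simpa using hx1.le), one_mul]
  · rcases lt_or_ge ‖x‖ (exp 1) with h | h
    · exact χ.contDiffAt.mul (contDiffAt_radialLog _ hx h)
    · refine (contDiffAt_const (c := (0 : ℝ))).congr_of_eventuallyEq ?_
      filter_upwards [continuous_norm.continuousAt.eventually_const_lt (he.trans_le h)] with y hy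
      rw [hχ hy.le, zero_mul]

lemma sub_one_div_pos (hn : 2 ≤ n) : 0 < ((n : ℝ) - 1) / n := by
  have : (2 : ℝ) ≤ n := by exact_mod_cast hn
  exact div_pos (by linarith) (by linarith)

namespace IsSmoothExtension

variable {u : EuclideanSpace ℝ (Fin n) → ℝ}

lemma norm_inv_norm_mul (hu : IsSmoothExtension u) {x : EuclideanSpace ℝ (Fin n)}
    (hx : 0 < ‖x‖) (hx1 : ‖x‖ < 1) :
    ‖‖x‖⁻¹ * u x‖ = ‖x‖ ^ (-(n : ℝ)) * log (exp 1 / ‖x‖) ^ (-(1 + ((n : ℝ) - 1) / n)) := by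
  have hlog := one_le_log_exp_one_div hx hx1.le
  rw [hu.eq_formula x hx hx1, radialLog, sub_eq_neg_add, rpow_add_one hx.ne',
    norm_of_nonneg (by positivity)]
  field_simp

lemma integrable_inv_norm_mul (hu : IsSmoothExtension u) (hn : 2 ≤ n) :
    Integrable fun x ↦ ‖x‖⁻¹ * u x := by
  have := nontrivial_euclideanSpace_fin (by omega : 0 < n)
  refine integrable_of_norm_le_rpow_mul_log (M := 1)
    ((continuousOn_id.norm.inv₀ fun _ hx ↦ norm_ne_zero_iff.2 hx).mul hu.smooth.continuousOn)
    hu.compact_support.mul_left (sub_one_div_pos hn) fun x hx hx1 ↦ ?_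
  rw [one_mul, finrank_euclideanSpace_fin, hu.norm_inv_norm_mul hx hx1]

lemma integrable (hu : IsSmoothExtension u) (hn : 2 ≤ n) : Integrable u := by
  have := nontrivial_euclideanSpace_fin (by omega : 0 < n)
  refine integrable_of_norm_le_rpow_mul_log (M := 1) hu.smooth.continuousOn hu.compact_support
    (sub_one_div_pos hn) fun x hx hx1 ↦ ?_
  rw [one_mul, finrank_euclideanSpace_fin, ← hu.norm_inv_norm_mul hx hx1, norm_mul, norm_inv,
    norm_norm]
  exact le_mul_of_one_le_left (norm_nonneg _) ((one_le_inv₀ hx).2 hx1.le)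

lemma eventuallyEq_radialLog (hu : IsSmoothExtension u) {x : EuclideanSpace ℝ (Fin n)}
    (hx : 0 < ‖x‖) (hx1 : ‖x‖ < 1) : u =ᶠ[𝓝 x] radialLog (1 + ((n : ℝ) - 1) / n) := by
  filter_upwards [continuous_norm.continuousAt.eventually_const_lt hx,
    continuous_norm.continuousAt.eventually_lt_const hx1] with y hy hy1
  exact hu.eq_formula y hy hy1

lemma integrable_gradient (hu : IsSmoothExtension u) (hn : 2 ≤ n) : Integrable (gradient u) := by
  have := nontrivial_euclideanSpace_fin (by omega : 0 < n)
  have hβ := sub_one_div_pos hn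
  refine integrable_of_norm_le_rpow_mul_log (M := (n : ℝ) - 1 + (1 + ((n : ℝ) - 1) / n))
    ((InnerProductSpace.toDual ℝ _).symm.continuous.comp_continuousOn
      (hu.smooth.continuousOn_fderiv_of_isOpen isOpen_compl_singleton (by simp)))
    ((hu.compact_support.fderiv (𝕜 := ℝ)).comp_left (map_zero _)) hβ fun x hx hx1 ↦ ?_
  rw [gradient, LinearIsometryEquiv.norm_map, (hu.eventuallyEq_radialLog hx hx1).fderiv_eq,
    finrank_euclideanSpace_fin]
  exact norm_fderiv_radialLog_le (by omega) (by positivity) hx hx1.le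

lemma memW11 (hu : IsSmoothExtension u) (hn : 2 ≤ n) : MemW11 u := by
  have := nontrivial_euclideanSpace_fin (by omega : 0 < n)
  have hd (x) (hx : x ≠ 0) : DifferentiableAt ℝ u x :=
    (hu.smooth.contDiffAt (isOpen_compl_singleton.mem_nhds hx)).differentiableAt (by simp)
  exact ⟨hu.integrable hn, gradient u, hu.integrable_gradient hn,
    isWeakGradient_gradient hd (hu.integrable hn).locallyIntegrable
      (hu.integrable_inv_norm_mul hn).locallyIntegrable
      (hu.integrable_gradient hn).locallyIntegrable⟩

end IsSmoothExtension

end SmoothExtension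

section SphericalMaximal

variable {n : ℕ}

lemma sphericalAverage_le_sphericalMaximal (u : EuclideanSpace ℝ (Fin n) → ℝ)
    (x : EuclideanSpace ℝ (Fin n)) {t : ℝ} (ht : 0 < t) :
    sphericalAverage u x t ≤ sphericalMaximal u x :=
  le_iSup₂ (f := fun t (_ : 0 < t) ↦ sphericalAverage u x t) t ht

lemma exists_le_sphericalAverage_of_isSmoothExtension (hn : 2 ≤ n) :
    ∃ C : ℝ, 0 < C ∧ ∀ u : EuclideanSpace ℝ (Fin n) → ℝ, IsSmoothExtension u →
      ∀ x, 0 < ‖x‖ → ‖x‖ ≤ 1 →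
        ENNReal.ofReal (C * radialLog (((n : ℝ) - 1) / n) x) ≤ sphericalAverage u x ‖x‖ := by
  obtain ⟨C, hC, h⟩ := exists_le_sphericalAverage hn (sub_one_div_pos hn)
  exact ⟨C, hC, fun u hu ↦ h u hu.eq_formula⟩

lemma le_of_ofReal_le_of_coe_eq {a b : ℝ} {c : ℝ≥0∞} (h : ENNReal.ofReal a ≤ c)
    (hc : (c : EReal) = b) : a ≤ b := by
  rw [← EReal.coe_le_coe_iff, ← hc]
  exact (EReal.coe_le_coe_iff.2 (le_max_left a 0)).trans
    (EReal.coe_ennreal_ofReal ▸ EReal.coe_ennreal_le_coe_ennreal_iff.2 h)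

lemma MemW11Loc.exists_ae_eq_memLp_restrict (hn : 2 ≤ n)
    {f : EuclideanSpace ℝ (Fin n) → ℝ≥0∞} (hf : MemW11Loc f) {K : Set (EuclideanSpace ℝ (Fin n))}
    (hK : IsCompact K) :
    ∃ g : EuclideanSpace ℝ (Fin n) → ℝ, (∀ᵐ x, (f x : EReal) = g x) ∧
      MemLp g (ENNReal.ofReal ((n : ℝ) / (n - 1))) (volume.restrict K) := by
  obtain ⟨g, hfg, hg, G, hG, hgG⟩ := hf
  have hp : NNReal.HolderConjugate (finrank ℝ (EuclideanSpace ℝ (Fin n)))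
      ((n : ℝ) / (n - 1)).toNNReal := by
    have hn1 : (1 : ℝ) < n := by exact_mod_cast hn
    rw [← NNReal.holderConjugate_coe_iff, finrank_euclideanSpace_fin,
      coe_toNNReal _ (div_nonneg (by linarith) (by linarith))]
    exact HolderConjugate.conjExponent hn1
  refine ⟨g, hfg, memLp_restrict_of_isWeakLineDeriv (b := (EuclideanSpace.basisFun _ ℝ).toBasis)
    (G := fun i x ↦ G x i) hp hg (locallyIntegrable_apply hG) ?_ hK⟩
  simpa using isWeakGradient_iff_isWeakLineDeriv.1 hgG

lemma IsSmoothExtension.not_memW11Loc_sphericalMaximal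
    {u : EuclideanSpace ℝ (Fin n) → ℝ} (hu : IsSmoothExtension u) (hn : 2 ≤ n) :
    ¬ MemW11Loc (sphericalMaximal u) := by
  intro h
  have := nontrivial_euclideanSpace_fin (by omega : 0 < n)
  obtain ⟨C, hC, hle⟩ := exists_le_sphericalAverage_of_isSmoothExtension hn
  obtain ⟨g, hg, hgp⟩ := h.exists_ae_eq_memLp_restrict hn (isCompact_closedBall 0 1)
  have hmeas : Measurable (radialLog (((n : ℝ) - 1) / n) : EuclideanSpace ℝ (Fin n) → ℝ) := by
    unfold radialLog
    fun_prop
  refine not_memLp_radialLog hn (closedBall_mem_nhds 0 one_pos)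
    (hgp.of_le_mul (c := C⁻¹) hmeas.aestronglyMeasurable ?_)
  have hne : ∀ᵐ x : EuclideanSpace ℝ (Fin n), x ≠ 0 := by simp [ae_iff]
  refine (ae_restrict_iff' measurableSet_closedBall).2 ?_
  filter_upwards [hg, hne] with x hgx hx hx1
  have hx0 := norm_pos_iff.2 hx
  rw [mem_closedBall_zero_iff] at hx1
  have hlower : C * radialLog (((n : ℝ) - 1) / n) x ≤ g x := le_of_ofReal_le_of_coe_eq
    ((hle u hu x hx0 hx1).trans (sphericalAverage_le_sphericalMaximal u x hx0)) hgx
  rw [norm_of_nonneg (radialLog_nonneg _ (hx1.trans (one_le_exp zero_le_one))),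
    le_inv_mul_iff₀ hC]
  exact hlower.trans (le_norm_self _)

end SphericalMaximal

theorem mainTheorem4 (n : ℕ) (hn : 2 ≤ n) :
    (∃ u : EuclideanSpace ℝ (Fin n) → ℝ, (∀ x, 0 ≤ u x) ∧ IsSmoothExtension u ∧
      HasCompactSupport u ∧ MemW11 u ∧ ¬ MemW11Loc (sphericalMaximal u)) ∧
    (∀ u : EuclideanSpace ℝ (Fin n) → ℝ, IsSmoothExtension u →
      MemW11 u ∧ ¬ MemW11Loc (sphericalMaximal u)) ∧
    (∃ C : ℝ, 0 < C ∧ ∀ u : EuclideanSpace ℝ (Fin n) → ℝ, IsSmoothExtension u →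
      ∀ x, 0 < ‖x‖ → ‖x‖ ≤ 1 →
        ENNReal.ofReal (C * radialLog (((n : ℝ) - 1) / n) x) ≤ sphericalAverage u x ‖x‖ ∧
        sphericalAverage u x ‖x‖ ≤ sphericalMaximal u x) ∧
    (∀ U ∈ 𝓝 (0 : EuclideanSpace ℝ (Fin n)),
      ¬ MemLp (radialLog (((n : ℝ) - 1) / n)) (ENNReal.ofReal ((n : ℝ) / ((n : ℝ) - 1)))
        (volume.restrict U)) := by
  refine ⟨?_, fun u hu ↦ ⟨hu.memW11 hn, hu.not_memW11Loc_sphericalMaximal hn⟩, ?_,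
    fun U hU ↦ not_memLp_radialLog hn hU⟩
  · obtain ⟨u, hu0, hu⟩ := exists_nonneg_isSmoothExtension (n := n)
    exact ⟨u, hu0, hu, hu.compact_support, hu.memW11 hn, hu.not_memW11Loc_sphericalMaximal hn⟩
  · obtain ⟨C, hC, h⟩ := exists_le_sphericalAverage_of_isSmoothExtension hn
    exact ⟨C, hC, fun u hu x hx hx1 ↦
      ⟨h u hu x hx hx1, sphericalAverage_le_sphericalMaximal u x hx⟩⟩
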